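/- Let $\Omega\subset\mathbb R^2$ be open and let $\mathcal S(\Omega)$ be the space of real Schwartz functions on $\mathbb R^2$ with support in $\Omega$, with the Schwartz topology; $\mathcal S'(\Omega)$ is its topological dual. For $u\in\mathcal S'(\Omega)$ the positive support $\operatorname{supp}_+(u)$ is the closure of the union of all open $U\subset\Omega$ such that $\langle u,\varphi\rangle>0$ for all $\varphi\in\mathcal S(\Omega)$ with $\varphi\ge 0$, $\varphi\not\equiv 0$ and $\operatorname{supp}\varphi\subset U$. The singular support $\operatorname{sing\,supp}(v)$ of a distribution $v$ on $\Omega$ is the set of those $x\in\Omega$ for which there is no $\chi\in C_c^\infty(\Omega)$ with $\chi\equiv1$ near $x$ and $\chi v\in C^\infty$. *Dampened ReLU.* Let $k$ be a smooth real kernel, that is, $k\in C^\infty(\Omega\times\mathbb R^2)$ such that for every compact $L\subset\Omega$ there is a compact $M\subset\Omega$ with $k(x,\cdot)$ supported in $M$ for all $x\in L$; put $u_k(x)=\langle u,k(x,\cdot)\rangle$, $x\in\Omega$. To every $u\in\mathcal S'(\Omega)$ let there be assigned a function $\kappa_u\in C^\infty(\Omega)$ such that the product $$\operatorname{ReLU}(u):=\mathbf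 1_{\operatorname{supp}_+(u)}\cdot\big((1-\kappa_u)\,u+\kappa_u\,u_k\big)\in\mathcal D'(\Omega)$$ is defined. Here the product $\mathbf 1_A v$ of an indicator function with a distribution $v$ on $\Omega$ is said to be defined if there is $\eta\in C^\infty(\Omega)$ such that $\mathbf 1_A(1-\eta)\in C^\infty(\Omega)$ and $\eta v=g$ is a locally integrable function on $\Omega$, and then $\mathbf 1_A v:=(\mathbf 1_A(1-\eta))\,v+\mathbf 1_A g$, which does not depend on $\eta$. (So $u$ is dampened, i.e. replaced by its local smoothing, near the boundary of its positive support wherever this is needed; $\kappa_u=1$ near that boundary is always admissible, and $\kappa_u=0$ is admissible for locally integrable $u$. For continuous $u$ and $\kappa_u=0$ one gets $\operatorname{ReLU}(u)(x)=\max\{0,u(x)\}$.) For $\gamma\ge 0$, the corresponding dampened soft-thresholding operator, generated by $S_\gamma(t)=\operatorname{sign}(t)\max(|t|-\gamma,0)=\max\{0,t-\gamma\}-\max\{0,-t-\gamma\}$, is $$\mathscr S_\gamma(u):=\operatorname{ReLU}(u-\gamma)-\operatorname{ReLU}(-u-\gamma).$$ *Claim.* For every open $\Omega\subset\mathbb R^2$,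 every choice of $k$ and $(\kappa_u)_u$ as above, every $\gamma\ge0$ and every $u\in\mathcal S'(\Omega)$, $$\operatorname{sing\,supp}(\mathscr S_\gamma(u))\subset\Big(\operatorname{sing\,supp}(u)\cap\big(\operatorname{int}(\operatorname{supp}_+(u-\gamma))\cup\operatorname{int}(\operatorname{supp}_+(-u-\gamma))\big)\Big)\cup\partial(\operatorname{supp}_+(u-\gamma))\cup\partial(\operatorname{supp}_+(-u-\gamma)).$$ -/

import Mathlib

open Set MeasureTheory TopologicalSpace
open scoped Topology ContDiff Distributions SchwartzMap

/-- The Euclidean plane. -/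
abbrev Plane := EuclideanSpace ℝ (Fin 2)

noncomputable section

/-! ### Tempered distributions on an open subset of the plane -/

/-- The space `𝒮(Ω)` of real Schwartz functions on the plane whose support lies in `Ω`,
with the topology of the Schwartz space. -/
def schwartzOn (Ω : Opens Plane) : Submodule ℝ 𝓢(Plane, ℝ) where
  carrier := {f | tsupport (f : Plane → ℝ) ⊆ Ω}
  zero_mem' := by
    change tsupport (fun _ : Plane => (0 : ℝ)) ⊆ Ω
    simp [tsupport, Function.support]
  add_mem' {f g} hf hg := by
    change tsupport ((f : Plane → ℝ) + (g : Plane → ℝ)) ⊆ Ω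
    exact (tsupport_add _ _).trans (union_subset hf hg)
  smul_mem' c f hf := by
    change tsupport ((fun _ : Plane => c) • (f : Plane → ℝ)) ⊆ Ω
    exact (tsupport_smul_subset_right (fun _ : Plane => c) (f : Plane → ℝ)).trans hf

/-- The space of (real) tempered distributions on `Ω`: the topological dual of `𝒮(Ω)`. -/
abbrev TemperedOn (Ω : Opens Plane) := schwartzOn Ω →L[ℝ] ℝ

namespace TemperedOn

variable {Ω : Opens Plane}

/-- The constant function `c`, as a tempered distribution on `Ω`. -/
def const (Ω : Opens Plane) (c : ℝ) : TemperedOn Ω :=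
  c • (SchwartzMap.integralCLM ℝ (volume : Measure Plane)).comp (schwartzOn Ω).subtypeL

/-- The positive support of a tempered distribution on `Ω`: the closure of the union of all open
`U ⊆ Ω` such that `u` is strictly positive on all nonnegative nonzero `φ ∈ 𝒮(Ω)` supported in `U`.
-/
def posSupport (u : TemperedOn Ω) : Set Plane :=
  closure (⋃₀ {U : Set Plane | IsOpen U ∧ U ⊆ Ω ∧
    ∀ φ : schwartzOn Ω, (∀ x, 0 ≤ φ.1 x) → tsupport (φ.1 : Plane → ℝ) ⊆ U → φ ≠ 0 → 0 < u φ})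

end TemperedOn

/-- The continuous inclusion of the test functions on `Ω` into `𝒮(Ω)`. -/
def testToSchwartzOn (Ω : Opens Plane) : 𝓓(Ω, ℝ) →L[ℝ] schwartzOn Ω :=
  TestFunction.mkCLM ℝ
    (fun φ => ⟨φ.hasCompactSupport.toSchwartzMap φ.contDiff, φ.tsupport_subset⟩)
    (fun _ _ => rfl) (fun _ _ => rfl)
    (by
      intro K hK
      refine Continuous.subtype_mk ?_ _
      let L : 𝓓_{K}(Plane, ℝ) →ₗ[ℝ] 𝓢(Plane, ℝ) :=
        { toFun := fun f => f.hasCompactSupport.toSchwartzMap f.contDiff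
          map_add' := fun _ _ => rfl
          map_smul' := fun _ _ => rfl }
      change Continuous L
      refine WithSeminorms.continuous_of_isBounded
        (ContDiffMapSupportedIn.withSeminorms ℝ Plane ℝ ⊤ K) (schwartz_withSeminorms ℝ Plane ℝ) L ?_
      rintro ⟨k, l⟩
      obtain ⟨R, hR⟩ := K.isCompact.isBounded.exists_norm_le
      refine ⟨{l}, ⟨max R 0 ^ k, by positivity⟩, fun f => ?_⟩
      refine SchwartzMap.seminorm_le_bound ℝ k l _ (apply_nonneg _ _) fun x => ?_
      change ‖x‖ ^ k * ‖iteratedFDeriv ℝ l (f : Plane → ℝ) x‖ ≤ _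
      simp only [Finset.sup_singleton]
      by_cases hx : x ∈ K
      · have h1 : ‖x‖ ≤ max R 0 := (hR x hx).trans (le_max_left _ _)
        have h2 := ContDiffMapSupportedIn.norm_iteratedFDeriv_apply_le_seminorm_top ℝ
          (i := l) (f := f) (x := x)
        exact mul_le_mul (pow_le_pow_left₀ (norm_nonneg _) h1 k) h2 (norm_nonneg _)
          (pow_nonneg (le_max_right _ _) k)
      · rw [f.iteratedFDeriv_zero_on_compl hx]
        simp only [Pi.zero_apply, norm_zero, mul_zero]
        change 0 ≤ (max R 0) ^ k * _
        exact mul_nonneg (by positivity) (apply_nonneg _ _))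

/-- The restriction to test functions of a tempered distribution on `Ω`. -/
def TemperedOn.toDistribution {Ω : Opens Plane} (u : TemperedOn Ω) : 𝓓'(Ω, ℝ) :=
  u.comp (testToSchwartzOn Ω)

/-! ### Operations on distributions -/

section Operations

variable {Ω : Opens Plane}

lemma contDiff_mul_of_contDiffOn {m f : Plane → ℝ} (hm : ContDiffOn ℝ ∞ m Ω)
    (hf : ContDiff ℝ ∞ f) (hs : tsupport f ⊆ Ω) : ContDiff ℝ ∞ (fun x => f x * m x) := by
  rw [contDiff_iff_contDiffAt]
  intro x
  by_cases hx : x ∈ Ω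
  · exact hf.contDiffAt.mul (hm.contDiffAt (Ω.isOpen.mem_nhds hx))
  · have h0 : f =ᶠ[𝓝 x] 0 := notMem_tsupport_iff_eventuallyEq.1 fun h => hx (hs h)
    refine (contDiffAt_const (c := (0 : ℝ))).congr_of_eventuallyEq ?_
    filter_upwards [h0] with y hy
    simp [hy]

lemma exists_cutoff (K : Compacts Plane) (hK : (K : Set Plane) ⊆ Ω) :
    ∃ χ : Plane → ℝ, ContDiff ℝ ∞ χ ∧ tsupport χ ⊆ Ω ∧ ∀ x ∈ K, χ x = 1 := by
  obtain ⟨L, hL, hKL, hLΩ⟩ := exists_compact_between K.isCompact Ω.isOpen hK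
  obtain ⟨f, hf, -, hs, h1⟩ := exists_contMDiff_support_eq_eq_one_iff
    (modelWithCornersSelf ℝ Plane) isOpen_interior K.isCompact.isClosed hKL
  refine ⟨f, hf.contDiff, ?_, fun x hx => (h1 x).1 hx⟩
  rw [tsupport, hs]
  exact (closure_minimal interior_subset hL.isClosed).trans hLΩ

/-- Multiplication of test functions on `Ω` by a smooth function on `Ω`. -/
def testMul (m : Plane → ℝ) (hm : ContDiffOn ℝ ∞ m Ω) : 𝓓(Ω, ℝ) →L[ℝ] 𝓓(Ω, ℝ) :=
  TestFunction.mkCLM ℝ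
    (fun φ => ⟨fun x => φ x * m x, contDiff_mul_of_contDiffOn hm φ.contDiff φ.tsupport_subset,
      φ.hasCompactSupport.mul_right, tsupport_mul_subset_left.trans φ.tsupport_subset⟩)
    (fun f g => by ext x; exact add_mul _ _ _) (fun c f => by ext x; exact mul_assoc _ _ _)
    (by
      intro K hK
      obtain ⟨χ, hχ, hχs, hχ1⟩ := exists_cutoff K hK
      have hg : ContDiff ℝ ∞ (fun x => χ x * m x) := contDiff_mul_of_contDiffOn hm hχ hχs
      refine Continuous.congr ((TestFunction.continuous_ofSupportedIn hK).comp
        (ContDiffMapSupportedIn.bilinLeftCLM (n := ⊤) (K := K)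
          (ContinuousLinearMap.mul ℝ ℝ) hg).continuous) fun f => ?_
      ext x
      change f x * (χ x * m x) = f x * m x
      by_cases hx : x ∈ K
      · rw [hχ1 x hx, one_mul]
      · have h0 : f x = 0 := f.zero_on_compl hx
        rw [h0, zero_mul, zero_mul])

/-- The product `m v` of a smooth function `m` on `Ω` and a distribution `v` on `Ω`. -/
def smoothMul (m : Plane → ℝ) (hm : ContDiffOn ℝ ∞ m Ω) (v : 𝓓'(Ω, ℝ)) : 𝓓'(Ω, ℝ) :=
  (testMul m hm).precompCompactConvergenceCLM ℝ v

/-- The distribution `φ ↦ ∫ φ g` on `Ω` defined by a locally integrable function `g` on `Ω`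
(the definition is only used for such `g`). -/
def ofFun (Ω : Opens Plane) (g : Plane → ℝ) : 𝓓'(Ω, ℝ) :=
  TestFunction.integralAgainstBilinCLM (ContinuousLinearMap.mul ℝ ℝ) volume g

/-- `v` is smooth near `x ∈ Ω`: there is a test function `χ` on `Ω`, equal to `1` in a
neighbourhood of `x`, such that `χ v` is a smooth function. -/
def SmoothNear (v : 𝓓'(Ω, ℝ)) (x : Plane) : Prop :=
  ∃ χ : 𝓓(Ω, ℝ), (∀ᶠ y in 𝓝 x, χ y = 1) ∧
    ∃ g : Plane → ℝ, ContDiff ℝ ∞ g ∧ smoothMul χ χ.contDiff.contDiffOn v = ofFun Ω g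

/-- The singular support of a distribution on `Ω`. -/
def singSupp (v : 𝓓'(Ω, ℝ)) : Set Plane := {x | x ∈ Ω ∧ ¬ SmoothNear v x}

/-! ### The product of the indicator function of a set with a distribution -/

/-- `w` is the product of the indicator function of `A` with the distribution `v`. It is defined as
soon as `v` is locally integrable where `1_A` fails to be smooth: for some smooth `η` on `Ω` such
that `1_A (1 - η)` is smooth on `Ω` and `η v` is a locally integrable function `g`,
`1_A v := (1_A (1 - η)) v + 1_A g`. -/
def IsIndicatorProd (A : Set Plane) (v w : 𝓓'(Ω, ℝ)) : Prop :=
  ∃ (η g : Plane → ℝ) (hη : ContDiffOn ℝ ∞ η Ω)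
    (hA : ContDiffOn ℝ ∞ (A.indicator fun x => 1 - η x) Ω),
    LocallyIntegrableOn g Ω ∧ smoothMul η hη v = ofFun Ω g ∧
    w = smoothMul (A.indicator fun x => 1 - η x) hA v + ofFun Ω (A.indicator g)

lemma smoothMul_apply {m : Plane → ℝ} (hm : ContDiffOn ℝ ∞ m Ω) (v : 𝓓'(Ω, ℝ)) (φ : 𝓓(Ω, ℝ)) :
    smoothMul m hm v φ = v (testMul m hm φ) := rfl

lemma testMul_apply {m : Plane → ℝ} (hm : ContDiffOn ℝ ∞ m Ω) (φ : 𝓓(Ω, ℝ)) (x : Plane) :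
    testMul m hm φ x = φ x * m x := rfl

lemma ofFun_apply {g : Plane → ℝ} (hg : LocallyIntegrableOn g Ω) (φ : 𝓓(Ω, ℝ)) :
    ofFun Ω g φ = ∫ x, φ x * g x := by
  exact TestFunction.integralAgainstBilinCLM_eq_integral
    (B := ContinuousLinearMap.mul ℝ ℝ) hg (f := φ)

lemma integrable_test_mul {g : Plane → ℝ} (hg : LocallyIntegrableOn g Ω) (φ : 𝓓(Ω, ℝ)) :
    Integrable fun x => φ x * g x := by
  simpa using φ.integrable_bilin (ContinuousLinearMap.mul ℝ ℝ) hg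

/-- The product with an indicator function is unique. -/
lemma IsIndicatorProd.unique {A : Set Plane} (hAm : MeasurableSet A) {v w₁ w₂ : 𝓓'(Ω, ℝ)}
    (h₁ : IsIndicatorProd A v w₁) (h₂ : IsIndicatorProd A v w₂) : w₁ = w₂ := by
  obtain ⟨η₁, g₁, hη₁, hA₁, hg₁, hv₁, rfl⟩ := h₁
  obtain ⟨η₂, g₂, hη₂, hA₂, hg₂, hv₂, rfl⟩ := h₂
  have e₁ : ∀ φ : 𝓓(Ω, ℝ), v (testMul η₁ hη₁ φ) = ∫ x, φ x * g₁ x := fun φ => by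
    rw [← smoothMul_apply, hv₁, ofFun_apply hg₁]
  have e₂ : ∀ φ : 𝓓(Ω, ℝ), v (testMul η₂ hη₂ φ) = ∫ x, φ x * g₂ x := fun φ => by
    rw [← smoothMul_apply, hv₂, ofFun_apply hg₂]
  have hae : ∀ᵐ x, x ∈ (Ω : Set Plane) → η₂ x * g₁ x - η₁ x * g₂ x = 0 := by
    refine Ω.isOpen.ae_eq_zero_of_integral_contDiff_smul_eq_zero ?_ ?_
    · exact (hg₁.continuousOn_mul hη₂.continuousOn Ω.isOpen.isLocallyClosed).sub
        (hg₂.continuousOn_mul hη₁.continuousOn Ω.isOpen.isLocallyClosed)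
    · intro f hf hfc hfs
      let φ : 𝓓(Ω, ℝ) := ⟨f, hf, hfc, hfs⟩
      have e : testMul η₁ hη₁ (testMul η₂ hη₂ φ) = testMul η₂ hη₂ (testMul η₁ hη₁ φ) := by
        ext x
        simp only [testMul_apply]
        ring
      have e' := congrArg v e
      rw [e₁, e₂, ← sub_eq_zero, ← integral_sub (integrable_test_mul hg₁ _)
        (integrable_test_mul hg₂ _)] at e'
      rw [← e']
      refine integral_congr_ae (.of_forall fun x => ?_)
      simp only [testMul_apply, smul_eq_mul]
      change f x * _ = f x * _ * _ - f x * _ * _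
      ring
  have hi₁ : LocallyIntegrableOn (A.indicator g₁) Ω := fun x hx => by
    obtain ⟨t, ht, hit⟩ := hg₁ x hx
    exact ⟨t, ht, hit.indicator hAm⟩
  have hi₂ : LocallyIntegrableOn (A.indicator g₂) Ω := fun x hx => by
    obtain ⟨t, ht, hit⟩ := hg₂ x hx
    exact ⟨t, ht, hit.indicator hAm⟩
  ext φ
  change v (testMul _ hA₁ φ) + ofFun Ω _ φ = v (testMul _ hA₂ φ) + ofFun Ω _ φ
  rw [ofFun_apply hi₁, ofFun_apply hi₂]
  have key : testMul _ hA₁ φ = testMul _ hA₂ φ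
      + (testMul η₁ hη₁ (testMul _ hA₁ φ - testMul _ hA₂ φ)
        + (testMul η₂ hη₂ (testMul _ hA₁ φ) - testMul η₁ hη₁ (testMul _ hA₁ φ))) := by
    ext x
    change φ x * _ = φ x * _ + ((φ x * _ - φ x * _) * _ + (φ x * _ * _ - φ x * _ * _))
    by_cases hx : x ∈ A
    · simp only [indicator_of_mem hx]
      ring
    · simp [indicator_of_notMem hx]
  have key' := congrArg v key
  rw [map_add v, map_add v, map_sub v, e₁, e₂, e₁] at key'
  rw [key', add_assoc, add_right_inj]
  set p := testMul _ hA₁ φ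
  set q := p - testMul _ hA₂ φ
  have hs : Integrable fun x => p x * g₂ x - p x * g₁ x :=
    (integrable_test_mul hg₂ p).sub (integrable_test_mul hg₁ p)
  have hs' : Integrable fun x => q x * g₁ x + (p x * g₂ x - p x * g₁ x) :=
    (integrable_test_mul hg₁ q).add hs
  rw [← integral_sub (integrable_test_mul hg₂ _) (integrable_test_mul hg₁ _),
    ← integral_add (integrable_test_mul hg₁ q) hs,
    ← integral_add hs' (integrable_test_mul hi₁ φ)]
  refine integral_congr_ae ?_
  filter_upwards [hae] with x hx
  change (φ x * _ - φ x * _) * _ + (φ x * _ * _ - φ x * _ * _) + _ = _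
  by_cases hxΩ : x ∈ (Ω : Set Plane)
  · have h := hx hxΩ
    by_cases hxA : x ∈ A
    · simp only [indicator_of_mem hxA]
      linear_combination φ x * h
    · simp [indicator_of_notMem hxA]
  · have h0 : φ x = 0 := image_eq_zero_of_notMem_tsupport fun h => hxΩ (φ.tsupport_subset h)
    simp [h0]

open Classical in
/-- The product of the indicator function of `A` with the distribution `v` (`0` if the product is
not defined). -/
def indicatorMul (A : Set Plane) (v : 𝓓'(Ω, ℝ)) : 𝓓'(Ω, ℝ) :=
  if h : ∃ w, IsIndicatorProd A v w then h.choose else 0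

end Operations

/-! ### Dampening, rectification and soft thresholding -/

/-- A smooth kernel on `Ω × Ω` with compact supports: for `x` in a compact subset of `Ω`, the
functions `k(x, ·)` are supported in a common compact subset of `Ω`. -/
structure SmoothingKernel (Ω : Opens Plane) where
  toFun : Plane → Plane → ℝ
  contDiffOn : ContDiffOn ℝ ∞ (fun p : Plane × Plane => toFun p.1 p.2) ((Ω : Set Plane) ×ˢ univ)
  exists_support : ∀ L : Set Plane, IsCompact L → L ⊆ Ω →
    ∃ M : Set Plane, IsCompact M ∧ M ⊆ Ω ∧ ∀ x ∈ L, Function.support (toFun x) ⊆ M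

namespace SmoothingKernel

variable {Ω : Opens Plane} (k : SmoothingKernel Ω)

/-- The test function `k(x, ·)`, for `x ∈ Ω`. -/
def test (x : Ω) : 𝓓(Ω, ℝ) where
  toFun := k.toFun x
  contDiff' := by
    have h : ContDiffOn ℝ ∞ (fun y : Plane => k.toFun x y) univ :=
      k.contDiffOn.comp (f := fun y : Plane => ((x : Plane), y))
        (contDiff_const.prodMk contDiff_id).contDiffOn fun y _ => ⟨x.2, mem_univ y⟩
    exact contDiffOn_univ.1 h
  hasCompactSupport' := by
    obtain ⟨M, hM, -, h⟩ := k.exists_support {(x : Plane)} isCompact_singleton (by simp)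
    exact HasCompactSupport.of_support_subset_isCompact hM (h x rfl)
  tsupport_subset' := by
    obtain ⟨M, hM, hMΩ, h⟩ := k.exists_support {(x : Plane)} isCompact_singleton (by simp)
    exact (closure_minimal (h x rfl) hM.isClosed).trans hMΩ

open Classical in
/-- The smoothed distribution `x ↦ ⟨u, k(x, ·)⟩`, a smooth function on `Ω`. -/
def smooth (u : TemperedOn Ω) (x : Plane) : ℝ :=
  if hx : x ∈ Ω then u.toDistribution (k.test ⟨x, hx⟩) else 0

end SmoothingKernel

/-- The dampened distribution `(1 - κ) u + κ u_k`, where `κ` is a smooth function on `Ω` and `u_k`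
is `u` smoothed with the kernel `k`. -/
def TemperedOn.dampen {Ω : Opens Plane} (k : SmoothingKernel Ω) (κ : Plane → ℝ)
    (hκ : ContDiffOn ℝ ∞ κ Ω) (u : TemperedOn Ω) : 𝓓'(Ω, ℝ) :=
  smoothMul (fun x => 1 - κ x) (contDiffOn_const.sub hκ) u.toDistribution +
    ofFun Ω (fun x => κ x * k.smooth u x)

/-- The parameters of a dampening procedure on `Ω`: a smooth kernel `k` with compact supports and,
for every `u`, a smooth localising function `κ_u`, such that the product of the dampened
distribution `(1 - κ_u) u + κ_u u_k` with the indicator function of the positive support of `u` is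
defined. For instance `κ_u = 1` near the boundary of the positive support is always allowed, and
`κ_u = 0` (no dampening) is allowed if `u` is a locally integrable function. -/
structure Dampening (Ω : Opens Plane) where
  kernel : SmoothingKernel Ω
  cutoff : TemperedOn Ω → Plane → ℝ
  contDiffOn_cutoff : ∀ u, ContDiffOn ℝ ∞ (cutoff u) Ω
  exists_prod : ∀ u : TemperedOn Ω, ∃ w,
    IsIndicatorProd u.posSupport (u.dampen kernel (cutoff u) (contDiffOn_cutoff u)) w

namespace Dampening

variable {Ω : Opens Plane} (D : Dampening Ω)

/-- The dampened `ReLU` operator: the dampened distribution, restricted to the positive support. -/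
def relu (u : TemperedOn Ω) : 𝓓'(Ω, ℝ) :=
  indicatorMul u.posSupport (u.dampen D.kernel (D.cutoff u) (D.contDiffOn_cutoff u))

/-- The dampened soft-thresholding operator, obtained by applying the dampened `ReLU` in the
identity `sign(t) max(|t| - γ, 0) = ReLU(t - γ) - ReLU(-t - γ)`, valid for `γ ≥ 0`. -/
def softThreshold (γ : ℝ) (u : TemperedOn Ω) : 𝓓'(Ω, ℝ) :=
  D.relu (u - TemperedOn.const Ω γ) - D.relu (-u - TemperedOn.const Ω γ)

end Dampening

end

/-! Smoothness of a distribution at a point is local, and off the boundary of a closed set `A` the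
function `1_A` is locally constant. Outside `A` the product `1_A v` vanishes; inside `int A` it
equals `v`, whichever `η` and `g` define it (`IsIndicatorProd.isSmoothAt`). Here `A` is a positive
support and `v = (1 - κ) u + κ u_k`. Since `u_k` is smooth on all of `Ω`, dampening creates no
singularities: `v` is smooth wherever `u` is (`IsSmoothAt.dampen`). Applying this to `u - γ` and `-u
- γ`, which differ from `±u` by a constant, gives the inclusion.

The analytic input is the smoothness of `u_k`, that is, differentiation of `⟨u, k(x, ·)⟩` under the
pairing. A continuous functional on test functions supported in a fixed compact set is bounded by
finitely many seminorms. The first-order Taylor remainder of the kernel in `x` is `o(‖x' - x‖)` in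
each of these, because the remainder and all its `y`-derivatives vanish to first order at `x`. The
derivative is a pairing of the same type, so induction applies (`contDiff_slice`). -/

/-! ### Pairing a distribution with a smooth family of test functions -/

section Parameter

variable {E : Type*} [NormedAddCommGroup E] [NormedSpace ℝ E]

/-- A `C¹` function of two variables which vanishes to first order along `{x} × E'` is `o(‖x' - x‖)`
uniformly on compact sets of `E'`. -/
lemma eventually_forall_norm_le_of_fderiv_eq_zero {E' : Type*} [NormedAddCommGroup E']
    [NormedSpace ℝ E'] {F : Type*} [NormedAddCommGroup F] [NormedSpace ℝ F] {G : E × E' → F}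
    (hG : ContDiff ℝ 1 G) {x : E} (h0 : ∀ y, G (x, y) = 0)
    (h1 : ∀ y v, fderiv ℝ G (x, y) (v, 0) = 0) {M : Set E'} (hM : IsCompact M)
    {ε : ℝ} (hε : 0 < ε) : ∀ᶠ x' in 𝓝 x, ∀ y ∈ M, ‖G (x', y)‖ ≤ ε * ‖x' - x‖ := by
  let D : E × E' → E →L[ℝ] F := fun p => (fderiv ℝ G p).comp (.inl ℝ E E')
  have hD : Continuous D := (hG.continuous_fderiv one_ne_zero).clm_comp continuous_const
  have hD0 : ∀ y, D (x, y) = 0 := fun y => by ext v; exact h1 y v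
  have hDG : ∀ x' y, HasFDerivAt (fun z => G (z, y)) (D (x', y)) x' := fun x' y =>
    ((hG.differentiable one_ne_zero).differentiableAt (x := (x', y))).hasFDerivAt.comp x'
      (hasFDerivAt_prodMk_left x' y)
  -- Compactness of `M` yields one neighbourhood of `x` for all `y`; the mean value inequality on a
  -- ball then gives the bound.
  have hev : ∀ᶠ x' in 𝓝 x, ∀ y ∈ M, ‖D (x', y)‖ < ε := by
    refine hM.eventually_forall_of_forall_eventually fun y _ => ?_
    have hc : ContinuousAt (fun z : E × E' => ‖D z‖) (x, y) := hD.norm.continuousAt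
    exact hc.eventually_lt continuousAt_const (by simpa [hD0] using hε)
  obtain ⟨δ, hδ, hball⟩ := Metric.eventually_nhds_iff_ball.1 hev
  filter_upwards [Metric.ball_mem_nhds x hδ] with x' hx' y hy
  have := (convex_ball x δ).norm_image_sub_le_of_norm_hasFDerivWithin_le
    (fun z _ => (hDG z y).hasFDerivWithinAt) (fun z hz => (hball z hz y hy).le)
    (Metric.mem_ball_self hδ) hx'
  simpa [h0] using this

/-- The partial derivatives in the second variable of a smooth function of two variables which
vanishes to first order along `{x} × E'` are `o(‖x' - x‖)` uniformly on compact sets of `E'`. -/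
lemma eventually_forall_norm_iteratedFDeriv_le (j : ℕ) {E' : Type} [NormedAddCommGroup E']
    [NormedSpace ℝ E'] {F : Type*} [NormedAddCommGroup F] [NormedSpace ℝ F] {G : E × E' → F}
    (hG : ContDiff ℝ ∞ G) {x : E} (h0 : ∀ y, G (x, y) = 0)
    (h1 : ∀ y v, fderiv ℝ G (x, y) (v, 0) = 0) {M : Set E'} (hM : IsCompact M)
    {ε : ℝ} (hε : 0 < ε) :
    ∀ᶠ x' in 𝓝 x, ∀ y ∈ M, ‖iteratedFDeriv ℝ j (fun z => G (x', z)) y‖ ≤ ε * ‖x' - x‖ := by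
  induction j generalizing F with
  | zero =>
    simpa using eventually_forall_norm_le_of_fderiv_eq_zero (hG.of_le (by simp)) h0 h1 hM hε
  | succ j ih =>
    have hG' : ContDiff ℝ ∞ (fderiv ℝ G) := hG.fderiv_right (by simp)
    -- The partial derivative in `y` satisfies the same hypotheses with values in `E' →L[ℝ] F`,
    -- hence the induction over all `F`. With `E' : Type` this space stays in the universe of `F`.
    let H : E × E' → E' →L[ℝ] F := fun p => (fderiv ℝ G p).comp (.inr ℝ E E')
    have hH : ContDiff ℝ ∞ H := hG'.clm_comp contDiff_const
    have hGH : ∀ x' y, HasFDerivAt (fun z => G (x', z)) (H (x', y)) y := fun x' y =>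
      ((hG.differentiable (by simp)).differentiableAt (x := (x', y))).hasFDerivAt.comp y
        (hasFDerivAt_prodMk_right x' y)
    have hd : ∀ p, HasFDerivAt (fderiv ℝ G) (fderiv ℝ (fderiv ℝ G) p) p := fun p =>
      ((hG'.differentiable (by simp)).differentiableAt).hasFDerivAt
    have key := ih hH (fun y => ?_) fun y v => ?_
    · filter_upwards [key] with x' hx' y hy
      rw [← norm_iteratedFDeriv_fderiv, funext fun z => (hGH x' z).fderiv]
      exact hx' y hy
    · refine (hGH x y).unique ?_
      simpa only [h0] using hasFDerivAt_const (0 : F) y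
    · ext w
      have e1 : fderiv ℝ H (x, y) (v, 0) w = fderiv ℝ (fderiv ℝ G) (x, y) (v, 0) (0, w) := by
        have : HasFDerivAt H _ (x, y) :=
          (hd (x, y)).clm_comp (hasFDerivAt_const (ContinuousLinearMap.inr ℝ E E') _)
        rw [this.fderiv]
        simp
      -- Symmetry of the second derivative turns `∂ₓ∂_y G` into `∂_y∂ₓ G`, which is zero because `∂ₓ
      -- G (x, ·)` vanishes identically.
      have hs : IsSymmSndFDerivAt ℝ G (x, y) :=
        (contDiff_infty.1 hG 2).contDiffAt.isSymmSndFDerivAt (by simp)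
      have e2 : HasFDerivAt (fun z => fderiv ℝ G (x, z) (v, 0)) _ y :=
        ((hd (x, y)).comp y (hasFDerivAt_prodMk_right x y)).clm_apply
          (hasFDerivAt_const ((v, 0) : E × E') y)
      simp only [h1] at e2
      have e3 := congrArg (· w) (e2.unique (hasFDerivAt_const (0 : F) y))
      rw [e1, hs.eq]
      simpa using e3

variable {E' : Type} [NormedAddCommGroup E'] [NormedSpace ℝ E'] {M : Compacts E'}

/-- The function `K(x, ·)`, for a smooth `K` with support in `E × M`. -/
noncomputable def slice (K : E × E' → ℝ) (hK : ContDiff ℝ ∞ K) (hs : ∀ x, ∀ y ∉ M, K (x, y) = 0)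
    (x : E) : 𝓓_{M}(E', ℝ) :=
  ⟨fun y => K (x, y), hK.comp (contDiff_const.prodMk contDiff_id), fun y hy => hs x y hy⟩

lemma contDiff_fderiv_apply_inl {K : E × E' → ℝ} (hK : ContDiff ℝ ∞ K) (v : E) :
    ContDiff ℝ ∞ fun p => fderiv ℝ K p (v, 0) :=
  (hK.fderiv_right (m := ∞) (by simp)).clm_apply contDiff_const

lemma hasFDerivAt_left {K : E × E' → ℝ} (hK : ContDiff ℝ ∞ K) (x : E) (y : E') :
    HasFDerivAt (fun z => K (z, y)) ((fderiv ℝ K (x, y)).comp (.inl ℝ E E')) x :=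
  ((hK.differentiable (by simp)).differentiableAt (x := (x, y))).hasFDerivAt.comp x
    (hasFDerivAt_prodMk_left x y)

/-- Differentiating in the parameter does not enlarge the support in `y`, so directional derivatives
of the kernel again have slices in `𝓓_{M}`. -/
lemma fderiv_apply_inl_eq_zero {K : E × E' → ℝ} (hK : ContDiff ℝ ∞ K)
    (hs : ∀ x, ∀ y ∉ M, K (x, y) = 0) (v : E) : ∀ x, ∀ y ∉ M, fderiv ℝ K (x, y) (v, 0) = 0 := by
  intro x y hy
  have h := hasFDerivAt_left hK x y
  simp only [hs _ y hy] at h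
  simpa using congrArg (· v) (h.unique (hasFDerivAt_const (0 : ℝ) x))

variable [FiniteDimensional ℝ E]

/-- Differentiation under the pairing with a distribution. -/
lemma hasFDerivAt_slice (T : 𝓓_{M}(E', ℝ) →L[ℝ] ℝ) (K : E × E' → ℝ)
    (hK : ContDiff ℝ ∞ K) (hs : ∀ x, ∀ y ∉ M, K (x, y) = 0) (x : E) :
    ∃ A : E →L[ℝ] ℝ, HasFDerivAt (fun z => T (slice K hK hs z)) A x ∧
      ∀ v, A v = T (slice _ (contDiff_fderiv_apply_inl hK v) (fderiv_apply_inl_eq_zero hK hs v) x)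
    := by
  let A₀ : E →ₗ[ℝ] ℝ :=
    { toFun := fun v => T (slice _ (contDiff_fderiv_apply_inl hK v)
        (fderiv_apply_inl_eq_zero hK hs v) x)
      map_add' := fun v w => by
        rw [← map_add]
        congr 1
        ext y
        change fderiv ℝ K (x, y) (v + w, 0) =
          fderiv ℝ K (x, y) (v, 0) + fderiv ℝ K (x, y) (w, 0)
        rw [← map_add]
        simp
      map_smul' := fun c v => by
        rw [← map_smul]
        congr 1
        ext y
        change fderiv ℝ K (x, y) (c • v, 0) = c • fderiv ℝ K (x, y) (v, 0)
        rw [← map_smul]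
        simp }
  refine ⟨A₀.toContinuousLinearMap, ?_, fun v => rfl⟩
  -- Only the finitely many derivative orders in `s` need to be controlled.
  obtain ⟨s, C, hC, hT⟩ := Seminorm.bound_of_continuous
    (ContDiffMapSupportedIn.withSeminorms ℝ E' ℝ ⊤ M) ((normSeminorm ℝ ℝ).comp T.toLinearMap)
    (by exact T.continuous.norm)
  have hC0 : 0 < (C : ℝ) := NNReal.coe_pos.2 (pos_iff_ne_zero.2 hC)
  -- First-order Taylor remainder of `K` in the parameter. By linearity, `T` applied to its slice is
  -- exactly the error in the derivative.
  let R : E × E' → ℝ := fun p => K p - K (x, p.2) - fderiv ℝ K (x, p.2) (p.1 - x, 0)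
  have hR : ContDiff ℝ ∞ R := by
    have hx : ContDiff ℝ ∞ fun p : E × E' => (x, p.2) := contDiff_const.prodMk contDiff_snd
    exact (hK.sub (hK.comp hx)).sub (((hK.fderiv_right (m := ∞) (by simp)).comp hx).clm_apply
      ((contDiff_fst.sub contDiff_const).prodMk contDiff_const))
  have hRs : ∀ x', ∀ y ∉ M, R (x', y) = 0 := fun x' y hy => by
    simp [R, hs _ y hy, fderiv_apply_inl_eq_zero hK hs _ _ y hy]
  have hR0 : ∀ y, R (x, y) = 0 := fun y => by
    have : ((0 : E), (0 : E')) = 0 := rfl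
    simp [R, this]
  have hR1 : ∀ y v, fderiv ℝ R (x, y) (v, 0) = 0 := fun y v => by
    have h1 := hasFDerivAt_left hR x y
    have h2 : HasFDerivAt (fun z => R (z, y)) (0 : E →L[ℝ] ℝ) x := by
      have h3 : HasFDerivAt (fun z => fderiv ℝ K (x, y) (z - x, 0))
          ((fderiv ℝ K (x, y)).comp (.inl ℝ E E')) x :=
        ((fderiv ℝ K (x, y)).comp (.inl ℝ E E')).hasFDerivAt.comp x (hasFDerivAt_sub_const x)
      rw [← sub_self ((fderiv ℝ K (x, y)).comp (.inl ℝ E E'))]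
      exact ((hasFDerivAt_left hK x y).sub_const (K (x, y))).sub h3
    simpa using congrArg (· v) (h1.unique h2)
  refine .of_isLittleO (Asymptotics.isLittleO_iff.2 fun c hc => ?_)
  have hev : ∀ᶠ x' in 𝓝 x, ∀ j ∈ s, ∀ y ∈ (M : Set E'),
      ‖iteratedFDeriv ℝ j (fun z => R (x', z)) y‖ ≤ c / C * ‖x' - x‖ :=
    s.eventually_all.2 fun j _ =>
      eventually_forall_norm_iteratedFDeriv_le j hR hR0 hR1 M.isCompact (by positivity)
  filter_upwards [hev] with x' hx'
  have e : T (slice K hK hs x') - T (slice K hK hs x) - A₀.toContinuousLinearMap (x' - x) =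
      T (slice R hR hRs x') := by
    change T _ - T _ - T _ = _
    rw [← map_sub, ← map_sub]
    rfl
  rw [e]
  have hb : (0 : ℝ) ≤ c / C * ‖x' - x‖ := by positivity
  have hsup : (s.sup fun i => ContDiffMapSupportedIn.seminorm ℝ E' ℝ ⊤ M i) (slice R hR hRs x') ≤
      c / C * ‖x' - x‖ := by
    refine Seminorm.finset_sup_apply_le hb fun j hj => ?_
    refine (ContDiffMapSupportedIn.seminorm_top_le_iff ℝ hb j _).2 fun y hy => ?_
    exact hx' j hj y hy
  calc ‖T (slice R hR hRs x')‖ ≤ C * _ := hT _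
    _ ≤ C * (c / C * ‖x' - x‖) := by gcongr
    _ = c * ‖x' - x‖ := by field_simp

/-- The pairing of a distribution with a smooth family of test functions supported in a fixed
compact set depends smoothly on the parameter. -/
lemma contDiff_slice (T : 𝓓_{M}(E', ℝ) →L[ℝ] ℝ) (K : E × E' → ℝ)
    (hK : ContDiff ℝ ∞ K) (hs : ∀ x, ∀ y ∉ M, K (x, y) = 0) :
    ContDiff ℝ ∞ fun x => T (slice K hK hs x) := by
  refine contDiff_infty.2 fun n => ?_
  induction n generalizing K with
  | zero =>
    refine contDiff_zero.2 (continuous_iff_continuousAt.2 fun x => ?_)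
    obtain ⟨A, hA, -⟩ := hasFDerivAt_slice T K hK hs x
    exact hA.continuousAt
  | succ n ih =>
    choose A hA hA' using hasFDerivAt_slice T K hK hs
    -- As `E` is finite-dimensional, smoothness of `A` may be tested on each vector `v`, where `A`
    -- is the pairing with the slices of `∂_v K`.
    refine contDiff_succ_iff_hasFDerivAt.2 ⟨A, contDiff_clm_apply_iff.2 fun v => ?_, hA⟩
    simp only [hA']
    exact ih _ _ _

end Parameter

/-! ### Local smoothness of distributions -/

section LocalSmoothness

variable {Ω : Opens Plane}

/-- The smoothed distribution is a smooth function. -/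
lemma SmoothingKernel.contDiffOn_smooth (k : SmoothingKernel Ω) (u : TemperedOn Ω) :
    ContDiffOn ℝ ∞ (k.smooth u) Ω := by
  intro x hx
  obtain ⟨r, hr, hrΩ⟩ := Metric.nhds_basis_closedBall.mem_iff.1 (Ω.isOpen.mem_nhds hx)
  let χ : ContDiffBump x := ⟨r / 2, r, by positivity, by linarith⟩
  have hχs : tsupport χ = Metric.closedBall x r := χ.tsupport_eq
  obtain ⟨M, hM, hMΩ, hkM⟩ := k.exists_support _ (isCompact_closedBall x r) hrΩ
  -- The bump function makes the kernel smooth on the whole product and its slices supported in the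
  -- single compact set `M`; near `x` nothing changes.
  let K : Plane × Plane → ℝ := fun p => χ p.1 * k.toFun p.1 p.2
  have hK : ContDiff ℝ ∞ K := by
    rw [contDiff_iff_contDiffAt]
    rintro ⟨z, y⟩
    have hχ : ContDiffAt ℝ ∞ (fun p : Plane × Plane => χ p.1) (z, y) :=
      (χ.contDiff.comp contDiff_fst).contDiffAt
    by_cases hz : z ∈ Ω
    · exact hχ.mul (k.contDiffOn.contDiffAt
        ((Ω.isOpen.prod isOpen_univ).mem_nhds ⟨hz, mem_univ y⟩))
    · have h0 : (χ : Plane → ℝ) =ᶠ[𝓝 z] 0 :=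
        notMem_tsupport_iff_eventuallyEq.1 fun h => hz (hrΩ (hχs ▸ h))
      refine (contDiffAt_const (c := (0 : ℝ))).congr_of_eventuallyEq ?_
      filter_upwards [continuousAt_fst.eventually h0] with p hp
      simp [K, hp]
  have hKs : ∀ z, ∀ y ∉ (⟨M, hM⟩ : Compacts Plane), K (z, y) = 0 := by
    intro z y hy
    by_cases hz : z ∈ Metric.closedBall x r
    · have : k.toFun z y = 0 := by
        by_contra h
        exact hy (hkM z hz h)
      simp [K, this]
    · have : χ z = 0 := image_eq_zero_of_notMem_tsupport fun h => hz (hχs ▸ h)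
      simp [K, this]
  let T : 𝓓_{(⟨M, hM⟩ : Compacts Plane)}(Plane, ℝ) →L[ℝ] ℝ :=
    (u.comp (testToSchwartzOn Ω)).comp (TestFunction.ofSupportedInCLM ℝ hMΩ)
  refine (ContDiffAt.congr_of_eventuallyEq
    (contDiff_slice T K hK hKs).contDiffAt ?_).contDiffWithinAt
  filter_upwards [χ.eventuallyEq_one, Ω.isOpen.mem_nhds hx] with z hz hzΩ
  rw [SmoothingKernel.smooth, dif_pos (SetLike.mem_coe.1 hzΩ)]
  change (u.comp (testToSchwartzOn Ω)) _ = (u.comp (testToSchwartzOn Ω)) _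
  congr 1
  ext y
  change k.toFun z y = χ z * k.toFun z y
  rw [hz, Pi.one_apply, one_mul]

/-- Near `x ∈ Ω`, the distribution `v` is given by a smooth function. -/
def IsSmoothAt (v : 𝓓'(Ω, ℝ)) (x : Plane) : Prop :=
  ∃ U : Opens Plane, x ∈ U ∧ U ≤ Ω ∧ ∃ g : Plane → ℝ, ContDiffOn ℝ ∞ g U ∧
    ∀ φ : 𝓓(Ω, ℝ), tsupport φ ⊆ U → v φ = ∫ y, φ y * g y

lemma integrable_test_mul_of_contDiffOn {U : Opens Plane} {g : Plane → ℝ}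
    (hg : ContDiffOn ℝ ∞ g U) (φ : 𝓓(Ω, ℝ)) (hφ : tsupport φ ⊆ U) :
    Integrable fun y => φ y * g y :=
  (contDiff_mul_of_contDiffOn hg φ.contDiff hφ).continuous.integrable_of_hasCompactSupport
    φ.hasCompactSupport.mul_right

/-- The local form needs neither a cutoff nor a globally smooth density, and passes to sums and
products by shrinking the neighbourhood. A bump function converts it back. -/
lemma smoothNear_iff_isSmoothAt {v : 𝓓'(Ω, ℝ)} {x : Plane} :
    SmoothNear v x ↔ IsSmoothAt v x := by
  constructor
  · rintro ⟨χ, hχ, g, hg, hv⟩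
    obtain ⟨U, hU, hUo, hxU⟩ := eventually_nhds_iff.1 hχ
    refine ⟨⟨U, hUo⟩, hxU, fun y hy => ?_, g, hg.contDiffOn, fun φ hφ => ?_⟩
    · refine χ.tsupport_subset (subset_tsupport _ ?_)
      simp [hU y hy]
    · have e : testMul χ χ.contDiff.contDiffOn φ = φ := by
        ext y
        rw [testMul_apply]
        by_cases hy : y ∈ tsupport φ
        · rw [hU y (hφ hy), mul_one]
        · rw [image_eq_zero_of_notMem_tsupport hy, zero_mul]
      rw [← ofFun_apply (hg.continuous.continuousOn.locallyIntegrableOn Ω.isOpen.measurableSet),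
        ← hv, smoothMul_apply, e]
  · rintro ⟨U, hxU, hUΩ, g, hg, hv⟩
    obtain ⟨r, hr, hrU⟩ := Metric.nhds_basis_closedBall.mem_iff.1 (U.isOpen.mem_nhds hxU)
    let χ₀ : ContDiffBump x := ⟨r / 2, r, by positivity, by linarith⟩
    have hχs : tsupport χ₀ ⊆ U := χ₀.tsupport_eq.trans_subset hrU
    let χ : 𝓓(Ω, ℝ) := ⟨χ₀, χ₀.contDiff, χ₀.hasCompactSupport, hχs.trans hUΩ⟩
    have hg' : ContDiff ℝ ∞ fun y => χ y * g y := contDiff_mul_of_contDiffOn hg χ.contDiff hχs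
    refine ⟨χ, χ₀.eventuallyEq_one, _, hg', ?_⟩
    ext φ
    rw [ofFun_apply (hg'.continuous.continuousOn.locallyIntegrableOn Ω.isOpen.measurableSet),
      smoothMul_apply, hv _ ((tsupport_mul_subset_right (f := φ)).trans hχs)]
    simp only [testMul_apply, mul_assoc]

lemma IsSmoothAt.mem {v : 𝓓'(Ω, ℝ)} {x : Plane} (hv : IsSmoothAt v x) : x ∈ Ω := by
  obtain ⟨U, hxU, hUΩ, -⟩ := hv
  exact hUΩ hxU

/-- Smooth functions are smooth as distributions. -/
lemma isSmoothAt_ofFun {g : Plane → ℝ} (hg : ContDiffOn ℝ ∞ g Ω) {x : Plane} (hx : x ∈ Ω) :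
    IsSmoothAt (ofFun Ω g) x :=
  ⟨Ω, hx, le_rfl, g, hg, fun φ _ =>
    ofFun_apply (hg.continuousOn.locallyIntegrableOn Ω.isOpen.measurableSet) φ⟩

lemma IsSmoothAt.smoothMul {m : Plane → ℝ} (hm : ContDiffOn ℝ ∞ m Ω) {v : 𝓓'(Ω, ℝ)}
    {x : Plane} (hv : IsSmoothAt v x) : IsSmoothAt (smoothMul m hm v) x := by
  obtain ⟨U, hxU, hUΩ, g, hg, hv⟩ := hv
  refine ⟨U, hxU, hUΩ, fun y => m y * g y, (hm.mono hUΩ).mul hg, fun φ hφ => ?_⟩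
  rw [smoothMul_apply, hv _ ((tsupport_mul_subset_left (f := φ)).trans hφ)]
  simp only [testMul_apply, mul_assoc]

lemma IsSmoothAt.add {v w : 𝓓'(Ω, ℝ)} {x : Plane} (hv : IsSmoothAt v x) (hw : IsSmoothAt w x) :
    IsSmoothAt (v + w) x := by
  obtain ⟨U, hxU, hUΩ, g, hg, hv⟩ := hv
  obtain ⟨V, hxV, -, h, hh, hw⟩ := hw
  have hg' : ContDiffOn ℝ ∞ g (U ⊓ V : Opens Plane) := hg.mono inter_subset_left
  have hh' : ContDiffOn ℝ ∞ h (U ⊓ V : Opens Plane) := hh.mono inter_subset_right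
  refine ⟨U ⊓ V, ⟨hxU, hxV⟩, inf_le_left.trans hUΩ, fun y => g y + h y, hg'.add hh',
    fun φ hφ => ?_⟩
  change v φ + w φ = _
  rw [hv φ (hφ.trans inter_subset_left), hw φ (hφ.trans inter_subset_right),
    ← integral_add (integrable_test_mul_of_contDiffOn hg' φ hφ)
      (integrable_test_mul_of_contDiffOn hh' φ hφ)]
  simp only [mul_add]

lemma IsSmoothAt.neg {v : 𝓓'(Ω, ℝ)} {x : Plane} (hv : IsSmoothAt v x) : IsSmoothAt (-v) x := by
  obtain ⟨U, hxU, hUΩ, g, hg, hv⟩ := hv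
  refine ⟨U, hxU, hUΩ, fun y => -g y, hg.neg, fun φ hφ => ?_⟩
  change -v φ = _
  rw [hv φ hφ, ← integral_neg]
  simp only [mul_neg]

lemma IsSmoothAt.sub {v w : 𝓓'(Ω, ℝ)} {x : Plane} (hv : IsSmoothAt v x) (hw : IsSmoothAt w x) :
    IsSmoothAt (v - w) x := by
  rw [sub_eq_add_neg]
  exact hv.add hw.neg

/-! ### Smoothness of constants, dampened distributions and indicator products -/

lemma TemperedOn.toDistribution_const (c : ℝ) :
    (TemperedOn.const Ω c).toDistribution = ofFun Ω fun _ => c := by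
  ext φ
  rw [ofFun_apply (continuousOn_const.locallyIntegrableOn Ω.isOpen.measurableSet),
    integral_mul_const, mul_comm]
  change c • SchwartzMap.integralCLM ℝ volume (φ.hasCompactSupport.toSchwartzMap φ.contDiff) = _
  rw [SchwartzMap.integralCLM_apply]
  rfl

lemma IsSmoothAt.dampen (k : SmoothingKernel Ω) {κ : Plane → ℝ} (hκ : ContDiffOn ℝ ∞ κ Ω)
    {u : TemperedOn Ω} {x : Plane} (hu : IsSmoothAt u.toDistribution x) :
    IsSmoothAt (u.dampen k κ hκ) x :=
  (hu.smoothMul _).add (isSmoothAt_ofFun (hκ.mul (k.contDiffOn_smooth u)) hu.mem)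

/-- The product of the indicator function of a closed set `A` with `v` is smooth off the boundary
of `A`, except possibly at interior points of `A` where `v` is not smooth. -/
lemma IsIndicatorProd.isSmoothAt {A : Set Plane} (hA : IsClosed A) {v w : 𝓓'(Ω, ℝ)}
    (h : IsIndicatorProd A v w) {x : Plane} (hx : x ∈ Ω) (hxA : x ∉ frontier A)
    (hv : x ∈ interior A → IsSmoothAt v x) : IsSmoothAt w x := by
  obtain ⟨η, g, hη, hAη, hg, hvg, rfl⟩ := h
  have hgA : LocallyIntegrableOn (A.indicator g) Ω := fun y hy => by
    obtain ⟨t, ht, hit⟩ := hg y hy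
    exact ⟨t, ht, hit.indicator hA.measurableSet⟩
  by_cases hxi : x ∈ interior A
  · obtain ⟨U, hxU, hUΩ, f, hf, hv⟩ := hv hxi
    refine ⟨U ⊓ ⟨interior A, isOpen_interior⟩, ⟨hxU, hxi⟩, inf_le_left.trans hUΩ, f,
      hf.mono inter_subset_left, fun φ hφ => ?_⟩
    have hφA : ∀ y ∉ A, φ y = 0 := fun y hy =>
      image_eq_zero_of_notMem_tsupport fun h => hy (interior_subset (hφ h).2)
    rw [← hv φ (hφ.trans inter_subset_left)]
    change smoothMul _ hAη v φ + ofFun Ω (A.indicator g) φ = v φ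
    -- On the support of `φ`, inside `A`, the two factors `1_A (1 - η)` and `η` add up to `1`; hence
    -- `w = v` there.
    have e : φ = testMul _ hAη φ + testMul η hη φ := by
      ext y
      change φ y = φ y * _ + φ y * η y
      by_cases hy : y ∈ A
      · rw [indicator_of_mem hy]
        ring
      · simp [hφA y hy]
    conv_rhs => rw [e]
    rw [map_add, ← smoothMul_apply hη, hvg, smoothMul_apply, ofFun_apply hgA, ofFun_apply hg]
    congr 2 with y
    by_cases hy : y ∈ A
    · rw [indicator_of_mem hy]
    · simp [hφA y hy]
  -- A closed set is its interior together with its frontier, so `x` has a neighbourhood missing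
  -- `A`, where both terms of `w` vanish.
  · have hxA' : x ∉ A := fun h => hxA (hA.frontier_eq ▸ ⟨h, hxi⟩)
    refine ⟨Ω ⊓ ⟨Aᶜ, hA.isOpen_compl⟩, ⟨hx, hxA'⟩, inf_le_left, 0, contDiffOn_const,
      fun φ hφ => ?_⟩
    have hφA : ∀ y ∈ A, φ y = 0 := fun y hy =>
      image_eq_zero_of_notMem_tsupport fun h => (hφ h).2 hy
    change smoothMul _ hAη v φ + ofFun Ω (A.indicator g) φ = _
    have e : testMul _ hAη φ = 0 := by
      ext y
      change φ y * _ = 0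
      by_cases hy : y ∈ A
      · rw [hφA y hy, zero_mul]
      · rw [indicator_of_notMem hy, mul_zero]
    have e' : ∀ y, φ y * A.indicator g y = 0 := fun y => by
      by_cases hy : y ∈ A
      · rw [hφA y hy, zero_mul]
      · rw [indicator_of_notMem hy, mul_zero]
    rw [smoothMul_apply, e, map_zero, ofFun_apply hgA]
    simp [e']

lemma Dampening.isIndicatorProd_relu (D : Dampening Ω) (u : TemperedOn Ω) :
    IsIndicatorProd u.posSupport
      (u.dampen D.kernel (D.cutoff u) (D.contDiffOn_cutoff u)) (D.relu u) := by
  rw [Dampening.relu, indicatorMul, dif_pos (D.exists_prod u)]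
  exact (D.exists_prod u).choose_spec

/-- The dampened `ReLU` of `u` is smooth off the boundary of the positive support of `u`, except
possibly at interior points of the positive support where `u` is not smooth. -/
lemma Dampening.isSmoothAt_relu (D : Dampening Ω) {u : TemperedOn Ω} {x : Plane} (hx : x ∈ Ω)
    (hxu : x ∉ frontier u.posSupport)
    (hu : x ∈ interior u.posSupport → IsSmoothAt u.toDistribution x) :
    IsSmoothAt (D.relu u) x :=
  (D.isIndicatorProd_relu u).isSmoothAt isClosed_closure hx hxu fun h => (hu h).dampen _ _

end LocalSmoothness

/-! ### The inclusion of singular supports -/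

theorem mainTheorem1 (Ω : TopologicalSpace.Opens Plane) (D : Dampening Ω) (γ : ℝ) (hγ : 0 ≤ γ)
    (u : TemperedOn Ω) :
    singSupp (D.softThreshold γ u) ⊆
      (singSupp u.toDistribution ∩
        (interior (u - TemperedOn.const Ω γ).posSupport ∪
          interior (-u - TemperedOn.const Ω γ).posSupport)) ∪
      (frontier (u - TemperedOn.const Ω γ).posSupport ∪
        frontier (-u - TemperedOn.const Ω γ).posSupport) := by
  rintro x ⟨hx, hns⟩
  by_contra hcon
  simp only [mem_union, mem_inter_iff, not_or, not_and] at hcon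
  obtain ⟨hint, hA, hB⟩ := hcon
  have hc : IsSmoothAt (TemperedOn.const Ω γ).toDistribution x := by
    rw [TemperedOn.toDistribution_const]
    exact isSmoothAt_ofFun contDiffOn_const hx
  -- For `x` outside the right-hand side, lying in either interior excludes `x` from the singular
  -- support of `u`. If it lies in neither, both rectified terms vanish near `x` and `u` need not be
  -- smooth there.
  have hu : x ∈ interior (u - TemperedOn.const Ω γ).posSupport ∨
      x ∈ interior (-u - TemperedOn.const Ω γ).posSupport → IsSmoothAt u.toDistribution x := by
    intro h
    by_contra hu
    have := hint ⟨hx, fun h => hu (smoothNear_iff_isSmoothAt.1 h)⟩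
    tauto
  refine hns (smoothNear_iff_isSmoothAt.2 ?_)
  exact (D.isSmoothAt_relu hx hA fun h => (hu (.inl h)).sub hc).sub
    (D.isSmoothAt_relu hx hB fun h => (hu (.inr h)).neg.sub hc)
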